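/- In online square packing, the input is a finite sequence $I$ of squares (items) whose side lengths are rational numbers in $(0,1]$. The items are presented one by one, and each has to be assigned irrevocably to a bin before the next one is known. A set of items may share a bin if they can be placed, axis-parallel and with pairwise disjoint interiors, inside a unit square. The cost $A(I)$ of a deterministic online algorithm $A$ is the number of non-empty bins that it uses for $I$, and $OPT(I)$ is the minimum number of bins in any packing of $I$. The (asymptotic) competitive ratio of $A$ is $$R_A=\limsup_{Q\to\infty}\frac{1}{Q}\,\sup\{A(I) : OPT(I)=Q\}\in[0,\infty].$$ Theorem. The competitive ratio of every deterministic online algorithm for square packing satisfies $R_A\ge 1.7515445$. -/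

import Mathlib

open scoped ENNReal

namespace SquarePacking

/-- An item: a square, given by its side length, a rational number in `(0, 1]`. -/
abbrev Item : Type := {s : ℚ // 0 < s ∧ s ≤ 1}

/-- The closed axis-parallel square with lower left corner `p` and side length `s`. -/
def square (p : ℝ × ℝ) (s : ℝ) : Set (ℝ × ℝ) :=
  Set.Icc p.1 (p.1 + s) ×ˢ Set.Icc p.2 (p.2 + s)

/-- A family of items can be packed into one bin: the items can be placed as axis-parallel
squares inside the closed unit square, with pairwise disjoint interiors (boundaries may touch). -/
def Fits {ι : Type} (item : ι → Item) : Prop :=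
  ∃ pos : ι → ℝ × ℝ,
    (∀ i, square (pos i) ((item i : ℚ) : ℝ) ⊆ square (0, 0) 1) ∧
    Pairwise fun i j => Disjoint (interior (square (pos i) ((item i : ℚ) : ℝ)))
      (interior (square (pos j) ((item j : ℚ) : ℝ)))

/-- `f` assigns a bin (named by a natural number) to every item of the input sequence `I`, and
the items of every bin can be packed into that bin. -/
def IsPacking (I : List Item) (f : Fin I.length → ℕ) : Prop :=
  ∀ b : ℕ, Fits fun i : {i : Fin I.length // f i = b} => I.get i.1

/-- The number of non-empty bins of an assignment. -/
def numBins {n : ℕ} (f : Fin n → ℕ) : ℕ := (Finset.univ.image f).card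

/-- The optimal offline cost of `I`: the least number of bins of a packing of `I`. -/
noncomputable def opt (I : List Item) : ℕ :=
  sInf {k : ℕ | ∃ f : Fin I.length → ℕ, IsPacking I f ∧ numBins f = k}

/-- A deterministic online algorithm: `bin past s` is the bin that receives the item `s` when the
items presented before it are `past`, in this order (the earlier packing decisions are determined
by `past`). On every input the resulting assignment has to be a packing. The algorithm commits
to bins only, not to positions inside a bin; this includes the algorithms that also
commit to positions. -/
structure OnlineAlgorithm where
  bin : List Item → Item → ℕ
  isPacking : ∀ I : List Item, IsPacking I fun i => bin (I.take i) (I.get i)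

namespace OnlineAlgorithm

/-- The number of bins used by the online algorithm `A` for the input `I`. -/
def cost (A : OnlineAlgorithm) (I : List Item) : ℕ :=
  numBins fun i : Fin I.length => A.bin (I.take i) (I.get i)

/-- The supremum (possibly `∞`) of the cost of `A` over all inputs of optimal cost `Q`. -/
noncomputable def worstCost (A : OnlineAlgorithm) (Q : ℕ) : ℝ≥0∞ :=
  ⨆ (I : List Item) (_ : opt I = Q), (A.cost I : ℝ≥0∞)

/-- The asymptotic competitive ratio of `A`, a value in `[0, ∞]`. -/
noncomputable def competitiveRatio (A : OnlineAlgorithm) : ℝ≥0∞ :=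
  Filter.limsup (fun Q : ℕ => A.worstCost Q / (Q : ℝ≥0∞)) Filter.atTop

end OnlineAlgorithm

end SquarePacking

/-!
The adversary presents many items of side slightly below `1 / 12`, then items of side slightly above
`1 / 4`, then items of side slightly above `1 / 3`. In the last two phases it chooses the sides
adaptively: after an item that opens a bin the next items are smaller, after any other item they are
larger. In the end a threshold separates the two kinds, so a large item complementary to the
threshold fits into no bin opened during the phase, while offline it can share a bin with all the
items that did not open one. Stopping after a phase with copies of such an item costs the algorithm
one further bin per copy, except for the bins of earlier phases that still have room.

How much room a bin can have is controlled by grids: the open unit square contains `(k - 1) ^ 2`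
points of the grid of mesh `1 / k`, and a square of side greater than `c / k` has at least `c ^ 2`
grid points in its interior. The grids with `k = 13, 4, 3` bound the items in a bin, and a dual
solution of the resulting linear program bounds the competitive ratio.
-/

lemma exists_equiv_of_map_univ_eq {ι κ α : Type*} [Fintype ι] [Fintype κ] {f : ι → α} {g : κ → α}
    (h : Finset.univ.val.map f = Finset.univ.val.map g) : ∃ σ : ι ≃ κ, ∀ i, g (σ i) = f i := by
  classical
  have hfib (a : α) : Fintype.card {i // f i = a} = Fintype.card {k // g k = a} := by
    simpa only [Multiset.count_map, eq_comm, Fintype.card_subtype, Finset.card_def,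
      Finset.filter_val] using congrArg (Multiset.count a) h
  exact ⟨Equiv.ofFiberEquiv fun a => Fintype.equivOfCardEq (hfib a),
    Equiv.ofFiberEquiv_map fun a => Fintype.equivOfCardEq (hfib a)⟩

lemma map_univ_val_eq_sum {ι α : Type*} [Fintype ι] (f : ι → α) :
    Finset.univ.val.map f = ∑ i, {f i} := by
  rw [← Multiset.sum_map_singleton (Finset.univ.val.map f), Multiset.map_map]
  rfl

lemma exists_add_eq_of_card_le {α : Type*} {m : Multiset α} {a b : ℕ} (h : m.card ≤ a + b) :
    ∃ m₁ m₂ : Multiset α, m₁ + m₂ = m ∧ m₁.card ≤ a ∧ m₂.card ≤ b := by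
  induction m using Quotient.inductionOn with
  | _ l =>
    simp only [Multiset.quot_mk_to_coe, Multiset.coe_card] at h
    refine ⟨l.take a, l.drop a, ?_, ?_, ?_⟩
    · simp only [Multiset.quot_mk_to_coe, Multiset.coe_add, List.take_append_drop]
    · simp only [Multiset.coe_card, List.length_take, inf_le_left]
    · simp only [Multiset.coe_card, List.length_drop]
      omega

lemma exists_sum_eq_of_card_le {α : Type*} {c k : ℕ} {m : Multiset α} (h : m.card ≤ c * k) :
    ∃ P : Fin k → Multiset α, ∑ i, P i = m ∧ ∀ i, (P i).card ≤ c := by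
  induction k generalizing m with
  | zero =>
    have hm : m = 0 := by simpa using h
    exact ⟨0, by simp [hm], fun i => i.elim0⟩
  | succ k ih =>
    obtain ⟨m₁, m₂, rfl, h₁, h₂⟩ := exists_add_eq_of_card_le (a := c) (b := c * k)
      (h.trans_eq (by ring))
    obtain ⟨P, rfl, hP⟩ := ih h₂
    exact ⟨Fin.cons m₁ P, by simp [Fin.sum_univ_succ], Fin.cases h₁ hP⟩

namespace SquarePacking

/-- The side length of an item as a real number. -/
noncomputable def side (s : Item) : ℝ := ((s : ℚ) : ℝ)

lemma side_pos (s : Item) : 0 < side s := Rat.cast_pos.2 s.2.1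

lemma exists_item_side_mem_Ioo {a b : ℝ} (ha : 0 ≤ a) (hab : a < b) (hb : b ≤ 1) :
    ∃ s : Item, side s ∈ Set.Ioo a b := by
  obtain ⟨q, haq, hqb⟩ := exists_rat_btwn hab
  have hq : 0 < q ∧ q ≤ 1 := ⟨mod_cast ha.trans_lt haq, mod_cast (hqb.trans_le hb).le⟩
  exact ⟨⟨q, hq⟩, haq, hqb⟩

lemma interior_square (p : ℝ × ℝ) (s : ℝ) :
    interior (square p s) = Set.Ioo p.1 (p.1 + s) ×ˢ Set.Ioo p.2 (p.2 + s) := by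
  rw [square, interior_prod_eq, interior_Icc, interior_Icc]

lemma square_subset_square_zero_iff {p : ℝ × ℝ} {s w : ℝ} (hs : 0 ≤ s) :
    square p s ⊆ square (0, 0) w ↔ (0 ≤ p.1 ∧ p.1 + s ≤ w) ∧ 0 ≤ p.2 ∧ p.2 + s ≤ w := by
  have h (a : ℝ) : (Set.Icc a (a + s)).Nonempty := Set.nonempty_Icc.2 (by linarith)
  have hsub (a : ℝ) : Set.Icc a (a + s) ⊆ Set.Icc 0 w ↔ 0 ≤ a ∧ a + s ≤ w :=
    Set.Icc_subset_Icc_iff (by linarith)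
  simp only [square, zero_add, Set.prod_subset_prod_iff, hsub, (h _).ne_empty, or_false]

lemma disjoint_interior_square_iff {p q : ℝ × ℝ} {s t : ℝ} (hs : 0 < s) (ht : 0 < t) :
    Disjoint (interior (square p s)) (interior (square q t)) ↔
      (p.1 + s ≤ q.1 ∨ q.1 + t ≤ p.1) ∨ p.2 + s ≤ q.2 ∨ q.2 + t ≤ p.2 := by
  have h (a b : ℝ) : Disjoint (Set.Ioo a (a + s)) (Set.Ioo b (b + t)) ↔
      a + s ≤ b ∨ b + t ≤ a := by
    rw [Set.Ioo_disjoint_Ioo, min_le_iff, le_max_iff, le_max_iff]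
    constructor
    · rintro ((h | h) | h | h)
      · linarith
      · exact Or.inl h
      · exact Or.inr h
      · linarith
    · exact Or.imp Or.inr Or.inl
  rw [interior_square, interior_square, Set.disjoint_prod, h, h]

/-- The items can be placed in the rectangle `[0, w] × [0, h]` without overlap, where two squares
do not overlap when a vertical or horizontal line separates them. -/
def FitsIn {ι : Type*} (w h : ℝ) (item : ι → Item) : Prop :=
  ∃ p : ι → ℝ × ℝ,
    (∀ i, (0 ≤ (p i).1 ∧ (p i).1 + side (item i) ≤ w) ∧
      0 ≤ (p i).2 ∧ (p i).2 + side (item i) ≤ h) ∧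
    Pairwise fun i j =>
      ((p i).1 + side (item i) ≤ (p j).1 ∨ (p j).1 + side (item j) ≤ (p i).1) ∨
      (p i).2 + side (item i) ≤ (p j).2 ∨ (p j).2 + side (item j) ≤ (p i).2

lemma fits_iff_fitsIn {ι : Type} {item : ι → Item} : Fits item ↔ FitsIn 1 1 item := by
  have hpos (s : Item) : (0 : ℝ) < (s : ℚ) := side_pos s
  simp only [Fits, FitsIn, side, square_subset_square_zero_iff (hpos _).le,
    disjoint_interior_square_iff (hpos _) (hpos _)]

namespace FitsIn

variable {ι κ : Type*} {w w' h h' : ℝ} {item : ι → Item} {item' : κ → Item}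

lemma comp (H : FitsIn w h item) {f : κ → ι} (hf : f.Injective) :
    FitsIn w h fun k => item (f k) := by
  obtain ⟨p, hin, hsep⟩ := H
  exact ⟨p ∘ f, fun k => hin (f k), fun k l hkl => hsep (hf.ne hkl)⟩

lemma mono (H : FitsIn w h item) (hw : w ≤ w') (hh : h ≤ h') : FitsIn w' h' item := by
  obtain ⟨p, hin, hsep⟩ := H
  exact ⟨p, fun i => ⟨⟨(hin i).1.1, (hin i).1.2.trans hw⟩, (hin i).2.1, (hin i).2.2.trans hh⟩,
    hsep⟩

lemma transpose (H : FitsIn w h item) : FitsIn h w item := by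
  obtain ⟨p, hin, hsep⟩ := H
  exact ⟨fun i => (p i).swap, fun i => (hin i).symm, fun i j hij => (hsep hij).symm⟩

lemma of_subsingleton [Subsingleton ι] (hw : ∀ i, side (item i) ≤ w)
    (hh : ∀ i, side (item i) ≤ h) : FitsIn w h item :=
  ⟨fun _ => 0, fun i => by simp [hw i, hh i], fun i j hij => (hij (Subsingleton.elim i j)).elim⟩

lemma beside (hw : 0 ≤ w) (hw' : 0 ≤ w') (H : FitsIn w h item) (H' : FitsIn w' h item') :
    FitsIn (w + w') h (Sum.elim item item') := by
  obtain ⟨p, hin, hsep⟩ := H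
  obtain ⟨q, hin', hsep'⟩ := H'
  refine ⟨Sum.elim p fun k => ((q k).1 + w, (q k).2), ?_, ?_⟩
  · rintro (i | k)
    · exact ⟨⟨(hin i).1.1, (hin i).1.2.trans (by linarith)⟩, (hin i).2⟩
    · refine ⟨?_, (hin' k).2⟩
      constructor <;> simp only [Sum.elim_inr] <;> linarith [(hin' k).1.1, (hin' k).1.2]
  · have hcross (i : ι) (k : κ) : (p i).1 + side (item i) ≤ (q k).1 + w := by
      linarith [(hin i).1.2, (hin' k).1.1]
    rintro (i | i) (k | k) hik
    · exact hsep (ne_of_apply_ne _ hik)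
    · exact Or.inl (Or.inl (hcross i k))
    · exact Or.inl (Or.inr (hcross k i))
    · refine (hsep' (ne_of_apply_ne _ hik)).imp_left (Or.imp ?_ ?_) <;>
        intro _ <;> simp only [Sum.elim_inr] <;> linarith

lemma side_add_side_le (H : FitsIn w w item) {i j : ι} (hij : i ≠ j) :
    side (item i) + side (item j) ≤ w := by
  obtain ⟨p, hin, hsep⟩ := H
  obtain ⟨⟨hix, hix'⟩, hiy, hiy'⟩ := hin i
  obtain ⟨⟨hjx, hjx'⟩, hjy, hjy'⟩ := hin j
  rcases hsep hij with (_ | _) | (_ | _) <;> linarith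

end FitsIn

/-- The items of the multiset `m` can be packed into a `w × h` rectangle. -/
def Packs (w h : ℝ) (m : Multiset Item) : Prop := FitsIn w h fun s : m => s.1

lemma packs_map_univ_iff {ι : Type*} [Fintype ι] {w h : ℝ} {item : ι → Item} :
    Packs w h (Finset.univ.val.map item) ↔ FitsIn w h item := by
  obtain ⟨σ, hσ⟩ := exists_equiv_of_map_univ_eq
    (Multiset.map_univ_coe (Finset.univ.val.map item))
  constructor
  · intro H
    convert H.comp σ.symm.injective using 2 with i
    rw [← hσ, σ.apply_symm_apply]
  · intro H
    have H' := H.comp σ.injective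
    simp only [hσ] at H'
    exact H'

lemma packs_add_iff {w h : ℝ} {m m' : Multiset Item} :
    Packs w h (m + m') ↔ FitsIn w h (Sum.elim (fun s : m => s.1) fun s : m' => s.1) := by
  have e : Finset.univ.val.map (Sum.elim (fun s : m => s.1) fun s : m' => s.1) = m + m' := by
    rw [map_univ_val_eq_sum, Fintype.sum_sum_type]
    simp only [Sum.elim_inl, Sum.elim_inr, ← map_univ_val_eq_sum, Multiset.map_univ_coe]
  rw [← packs_map_univ_iff, e]

namespace Packs

variable {w w' h h' : ℝ} {m m' : Multiset Item}

lemma mono (H : Packs w h m) (hw : w ≤ w') (hh : h ≤ h') : Packs w' h' m := FitsIn.mono H hw hh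

lemma transpose (H : Packs w h m) : Packs h w m := FitsIn.transpose H

lemma beside (hw : 0 ≤ w) (hw' : 0 ≤ w') (H : Packs w h m) (H' : Packs w' h m') :
    Packs (w + w') h (m + m') :=
  packs_add_iff.2 (FitsIn.beside hw hw' H H')

lemma above (hh : 0 ≤ h) (hh' : 0 ≤ h') (H : Packs w h m) (H' : Packs w h' m') :
    Packs w (h + h') (m + m') :=
  (beside hh hh' H.transpose H'.transpose).transpose

lemma of_le (H : Packs w h m) (hm : m' ≤ m) : Packs w h m' := by
  obtain ⟨m, rfl⟩ := Multiset.le_iff_exists_add.1 hm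
  exact (packs_add_iff.1 H).comp Sum.inl_injective

lemma of_card_le_one (hm : m.card ≤ 1) (hw : ∀ s ∈ m, side s ≤ w) (hh : ∀ s ∈ m, side s ≤ h) :
    Packs w h m :=
  have : Subsingleton m := Fintype.card_le_one_iff_subsingleton.1 (by simpa using hm)
  FitsIn.of_subsingleton (fun _ => hw _ Multiset.coe_mem) (fun _ => hh _ Multiset.coe_mem)

lemma sum_beside {k : ℕ} {P : Fin k → Multiset Item} (hw : 0 ≤ w) (H : ∀ i, Packs w h (P i)) :
    Packs (k * w) h (∑ i, P i) := by
  induction k with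
  | zero => exact of_card_le_one (by simp) (by simp) (by simp)
  | succ k ih =>
    rw [Fin.sum_univ_succ]
    exact (beside hw (by positivity) (H 0) (ih fun i => H i.succ)).mono
      (by push_cast; linarith) le_rfl

lemma row {s : ℝ} (hs : 0 ≤ s) {a : ℕ} (hm : ∀ t ∈ m, side t ≤ s) (hc : m.card ≤ a) :
    Packs (a * s) s m := by
  obtain ⟨P, rfl, hP⟩ := exists_sum_eq_of_card_le (c := 1) (hc.trans_eq (one_mul a).symm)
  have hside (i : Fin a) : ∀ t ∈ P i, side t ≤ s := fun t ht =>
    hm t (Multiset.mem_sum.2 ⟨i, Finset.mem_univ i, ht⟩)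
  exact sum_beside hs fun i => of_card_le_one (hP i) (hside i) (hside i)

lemma block {s : ℝ} (hs : 0 ≤ s) (a b : ℕ) (hm : ∀ t ∈ m, side t ≤ s) (hc : m.card ≤ a * b)
    (hw : a * s ≤ w) (hh : b * s ≤ h) : Packs w h m := by
  obtain ⟨P, rfl, hP⟩ := exists_sum_eq_of_card_le hc
  have hrow (i : Fin b) : Packs s (a * s) (P i) :=
    (row hs (fun t ht => hm t (Multiset.mem_sum.2 ⟨i, Finset.mem_univ i, ht⟩)) (hP i)).transpose
  exact (sum_beside hs hrow).transpose.mono hw hh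

lemma side_add_side_le {s u : Item} (H : Packs w w (m + {u})) (hs : s ∈ m) :
    side s + side u ≤ w := by
  have hle : ({s} + {u} : Multiset Item) ≤ m + {u} := by gcongr; simpa using hs
  have e : Finset.univ.val.map ![s, u] = {s} + {u} := by simp [Fin.univ_val_map]; rfl
  have H' := H.of_le hle
  rw [← e, packs_map_univ_iff] at H'
  exact H'.side_add_side_le (i := 0) (j := 1) (by decide)

end Packs

/-- The `m` consecutive integers that follow `k * x`. They stand for points of the mesh `1 / k`
inside an interval that starts at `x`; scaling by `k` keeps them in `ℤ`. -/
noncomputable def gridPoints (k m : ℕ) (x : ℝ) : Finset ℤ :=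
  Finset.Icc (⌊k * x⌋ + 1) (⌊k * x⌋ + m)

lemma cast_mem_Ioo_of_mem_gridPoints {k m : ℕ} {x s : ℝ} {a : ℤ} (hm : (m : ℝ) < k * s)
    (ha : a ∈ gridPoints k m x) : (a : ℝ) ∈ Set.Ioo (k * x) (k * (x + s)) := by
  rw [gridPoints, Finset.mem_Icc] at ha
  have hlow : ((⌊k * x⌋ : ℤ) : ℝ) + 1 ≤ a := mod_cast ha.1
  have hhigh : (a : ℝ) ≤ (⌊k * x⌋ : ℤ) + m := mod_cast ha.2
  constructor <;> linarith [Int.lt_floor_add_one (k * x), Int.floor_le (k * x)]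

lemma disjoint_gridPoints {k m n : ℕ} {x y s t : ℝ} (hm : (m : ℝ) < k * s)
    (hn : (n : ℝ) < k * t) (h : x + s ≤ y ∨ y + t ≤ x) :
    Disjoint (gridPoints k m x) (gridPoints k n y) := by
  have hk : (0 : ℝ) ≤ k := k.cast_nonneg
  refine Finset.disjoint_left.2 fun a hx hy => ?_
  obtain ⟨hxl, hxr⟩ := cast_mem_Ioo_of_mem_gridPoints hm hx
  obtain ⟨hyl, hyr⟩ := cast_mem_Ioo_of_mem_gridPoints hn hy
  rcases h with h | h <;> linarith [mul_le_mul_of_nonneg_left h hk]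

lemma gridPoints_subset_Ioo {k m : ℕ} {x s : ℝ} (hm : (m : ℝ) < k * s) (h₀ : 0 ≤ x)
    (h₁ : x + s ≤ 1) : gridPoints k m x ⊆ Finset.Ioo 0 (k : ℤ) := by
  have hk : (0 : ℝ) ≤ k := k.cast_nonneg
  intro a ha
  obtain ⟨hl, hr⟩ := cast_mem_Ioo_of_mem_gridPoints hm ha
  have hpos : (0 : ℝ) < a := (mul_nonneg hk h₀).trans_lt hl
  have hlt : (a : ℝ) < k := hr.trans_le (mul_le_of_le_one_right hk h₁)
  exact Finset.mem_Ioo.2 ⟨mod_cast hpos, mod_cast hlt⟩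

/-- A square of side greater than `m / k` contains an `m × m` block of points of the mesh `1 / k`,
and the unit square has `(k - 1) ^ 2` interior mesh points. -/
lemma FitsIn.sum_sq_le {ι : Type*} [Fintype ι] {item : ι → Item} (H : FitsIn 1 1 item) {k : ℕ}
    {m : ι → ℕ} (hm : ∀ i, (m i : ℝ) < k * side (item i)) : ∑ i, m i ^ 2 ≤ (k - 1) ^ 2 := by
  obtain ⟨p, hin, hsep⟩ := H
  let G (i : ι) : Finset (ℤ × ℤ) := gridPoints k (m i) (p i).1 ×ˢ gridPoints k (m i) (p i).2
  have hcard (i : ι) : (G i).card = m i ^ 2 := by simp [G, gridPoints, sq]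
  have hdisj : ((Finset.univ : Finset ι) : Set ι).PairwiseDisjoint G := fun i _ j _ hij =>
    Finset.disjoint_product.2 <|
      (hsep hij).imp (disjoint_gridPoints (hm i) (hm j)) (disjoint_gridPoints (hm i) (hm j))
  have hsub : Finset.univ.biUnion G ⊆ Finset.Ioo 0 (k : ℤ) ×ˢ Finset.Ioo 0 (k : ℤ) :=
    Finset.biUnion_subset.2 fun i _ => Finset.product_subset_product
      (gridPoints_subset_Ioo (hm i) (hin i).1.1 (hin i).1.2)
      (gridPoints_subset_Ioo (hm i) (hin i).2.1 (hin i).2.2)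
  calc ∑ i, m i ^ 2 = (Finset.univ.biUnion G).card := by
        simp only [Finset.card_biUnion hdisj, hcard]
    _ ≤ (Finset.Ioo 0 (k : ℤ) ×ˢ Finset.Ioo 0 (k : ℤ)).card := Finset.card_le_card hsub
    _ = (k - 1) ^ 2 := by
        rw [Finset.card_product, Int.card_Ioo, ← sq]
        congr 1
        omega

/-- The largest natural number `m` with `m / k < side s`. -/
noncomputable def gridSide (k : ℕ) (s : Item) : ℕ := ⌈k * side s⌉₊ - 1

lemma gridSide_lt (k : ℕ) [NeZero k] (s : Item) : (gridSide k s : ℝ) < k * side s := by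
  have h : 0 < k * side s := mul_pos (mod_cast NeZero.pos k) (side_pos s)
  have hceil := Nat.ceil_lt_add_one h.le
  rw [gridSide, Nat.cast_sub (Nat.ceil_pos.2 h)]
  push_cast
  linarith

lemma le_gridSide {k m : ℕ} {s : Item} (h : (m : ℝ) < k * side s) : m ≤ gridSide k s :=
  Nat.le_sub_one_of_lt (Nat.lt_ceil.2 h)

/-- A lower bound on the number of points of the mesh `1 / k` that the items of `m` cover, in
whatever way they are placed. -/
noncomputable def gridLoad (k : ℕ) (m : Multiset Item) : ℕ := (m.map fun s => gridSide k s ^ 2).sum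

lemma gridLoad_add (k : ℕ) (m m' : Multiset Item) :
    gridLoad k (m + m') = gridLoad k m + gridLoad k m' := by
  simp [gridLoad]

lemma sq_mul_card_le_gridLoad {k c : ℕ} {m : Multiset Item} (hm : ∀ s ∈ m, (c : ℝ) < k * side s) :
    c ^ 2 * m.card ≤ gridLoad k m := by
  rw [mul_comm, ← smul_eq_mul, gridLoad, ← Multiset.card_map (fun s => gridSide k s ^ 2) m]
  refine Multiset.card_nsmul_le_sum fun n hn => ?_
  obtain ⟨s, hs, rfl⟩ := Multiset.mem_map.1 hn
  exact Nat.pow_le_pow_left (le_gridSide (hm s hs)) 2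

lemma Packs.gridLoad_le {m : Multiset Item} (H : Packs 1 1 m) (k : ℕ) [NeZero k] :
    gridLoad k m ≤ (k - 1) ^ 2 := by
  have e : ∑ s : m, gridSide k s.1 ^ 2 = gridLoad k m :=
    congrArg Multiset.sum (m.map_univ fun s => gridSide k s ^ 2)
  exact e ▸ FitsIn.sum_sq_le H fun s : m => gridSide_lt k s.1

lemma Packs.card_mul_sq_le {m : Multiset Item} (H : Packs 1 1 m) {k c : ℕ} [NeZero k]
    (hm : ∀ s ∈ m, (c : ℝ) < k * side s) : c ^ 2 * m.card ≤ (k - 1) ^ 2 :=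
  (sq_mul_card_le_gridLoad hm).trans (H.gridLoad_le k)

/-- The items of `m` can be packed into `k` bins, some of which may stay empty. -/
def PackIn (k : ℕ) (m : Multiset Item) : Prop :=
  ∃ P : Fin k → Multiset Item, ∑ i, P i = m ∧ ∀ i, Packs 1 1 (P i)

lemma PackIn.add {k l : ℕ} {m m' : Multiset Item} (H : PackIn k m) (H' : PackIn l m') :
    PackIn (k + l) (m + m') := by
  obtain ⟨P, rfl, hP⟩ := H
  obtain ⟨P', rfl, hP'⟩ := H'
  refine ⟨Fin.append P P', by simp [Fin.sum_univ_add], fun i => ?_⟩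
  induction i using Fin.addCases with
  | left i => simpa using hP i
  | right i => simpa using hP' i

lemma PackIn.opt_le {I : List Item} {k : ℕ} (H : PackIn k I) : opt I ≤ k := by
  obtain ⟨P, hsum, hP⟩ := H
  have hitems : Finset.univ.val.map (fun x : Σ i, P i => x.2.1) = ∑ i, P i := by
    rw [map_univ_val_eq_sum, Fintype.sum_sigma]
    simp only [← map_univ_val_eq_sum, Multiset.map_univ_coe]
  obtain ⟨σ, hσ⟩ := exists_equiv_of_map_univ_eq (f := I.get) (by
    rw [hitems, hsum, Fin.univ_val_map, List.ofFn_get])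
  have hfits (b : ℕ) : Fits fun a : {a // ((σ a).1 : ℕ) = b} => I.get a.1 := by
    rw [fits_iff_fitsIn]
    by_cases hb : b < k
    · let τ (a : {a // ((σ a).1 : ℕ) = b}) : P ⟨b, hb⟩ :=
        Equiv.sigmaSubtype (β := fun i => P i) ⟨b, hb⟩ ⟨σ a.1, Fin.ext a.2⟩
      have hτ : τ.Injective := fun a a' h =>
        Subtype.ext (σ.injective (congrArg Subtype.val ((Equiv.injective _) h)))
      have hval (x : {x : Σ i, P i // x.1 = ⟨b, hb⟩}) : (Equiv.sigmaSubtype _ x).1 = x.1.2.1 := by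
        obtain ⟨⟨i, s⟩, hi⟩ := x
        obtain rfl : i = ⟨b, hb⟩ := hi
        rfl
      simpa only [τ, hval, hσ] using (hP ⟨b, hb⟩).comp hτ
    · have : IsEmpty {a // ((σ a).1 : ℕ) = b} := ⟨fun a => hb (a.2 ▸ (σ a.1).1.2)⟩
      exact FitsIn.of_subsingleton (fun a => isEmptyElim a) fun a => isEmptyElim a
  calc opt I ≤ numBins fun a => ((σ a).1 : ℕ) := Nat.sInf_le ⟨_, hfits, rfl⟩
    _ ≤ (Finset.range k).card := Finset.card_le_card <|
        Finset.image_subset_iff.2 fun a _ => Finset.mem_range.2 (σ a).1.2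
    _ = k := Finset.card_range k

lemma exists_isPacking_numBins_eq_opt (I : List Item) :
    ∃ f : Fin I.length → ℕ, IsPacking I f ∧ numBins f = opt I := by
  refine Nat.sInf_mem (s := {k | ∃ f : Fin I.length → ℕ, IsPacking I f ∧ numBins f = k})
    ⟨_, Fin.val, fun b => fits_iff_fitsIn.2 ?_, rfl⟩
  have : Subsingleton {i : Fin I.length // (i : ℕ) = b} :=
    ⟨fun i j => Subtype.ext (Fin.ext (i.2.trans j.2.symm))⟩
  have hside (s : Item) : side s ≤ 1 := mod_cast Rat.cast_le.2 s.2.2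
  exact FitsIn.of_subsingleton (fun i => hside _) fun i => hside _

lemma gridLoad_le_mul_opt (k : ℕ) [NeZero k] (I : List Item) :
    gridLoad k I ≤ (k - 1) ^ 2 * opt I := by
  obtain ⟨f, hf, hopt⟩ := exists_isPacking_numBins_eq_opt I
  have hbin (b : ℕ) : ∑ i with f i = b, gridSide k (I.get i) ^ 2 ≤ (k - 1) ^ 2 := by
    rw [Finset.sum_subtype (p := fun i => f i = b) _ (by simp)]
    exact (fits_iff_fitsIn.1 (hf b)).sum_sq_le fun i => gridSide_lt k _
  calc gridLoad k I = ∑ i, gridSide k (I.get i) ^ 2 := by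
        simp [gridLoad, Fin.sum_univ_fun_getElem I fun s => gridSide k s ^ 2]
    _ = ∑ b ∈ Finset.univ.image f, ∑ i with f i = b, gridSide k (I.get i) ^ 2 :=
        (Finset.sum_fiberwise_of_maps_to (fun i hi => Finset.mem_image_of_mem f hi) _).symm
    _ ≤ ∑ _b ∈ Finset.univ.image f, (k - 1) ^ 2 := Finset.sum_le_sum fun b _ => hbin b
    _ = (k - 1) ^ 2 * opt I := by rw [Finset.sum_const, smul_eq_mul, mul_comm, ← hopt, numBins]

lemma card_le_mul_opt {k : ℕ} [NeZero k] {m : Multiset Item} {I : List Item}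
    (hm : ∀ s ∈ m, 1 < k * side s) (hI : m ≤ I) : m.card ≤ (k - 1) ^ 2 * opt I := by
  obtain ⟨m', hm'⟩ := Multiset.le_iff_exists_add.1 hI
  calc m.card = 1 ^ 2 * m.card := by simp
    _ ≤ gridLoad k m := sq_mul_card_le_gridLoad (by simpa using hm)
    _ ≤ gridLoad k I := by simp [hm', gridLoad_add]
    _ ≤ (k - 1) ^ 2 * opt I := gridLoad_le_mul_opt k I

namespace OnlineAlgorithm

variable (A : OnlineAlgorithm) (past l l' : List Item) (s : Item) (b : ℕ)

/-- The bins that `A` assigns to the items of `l` when these are presented after `past`. -/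
def assign (i : Fin l.length) : ℕ := A.bin (past ++ l.take i) (l.get i)

/-- The bins that receive an item of `l` when `l` is presented after `past`. -/
def bins : Finset ℕ := Finset.univ.image (A.assign past l)

/-- The items of `l` that bin `b` receives when `l` is presented after `past`. -/
def content : Multiset Item := ∑ i, if A.assign past l i = b then {l.get i} else 0

lemma bins_nil : A.bins past [] = ∅ := rfl

lemma bins_cons : A.bins past (s :: l) = insert (A.bin past s) (A.bins (past ++ [s]) l) := by
  have hsucc : A.assign past (s :: l) ∘ Fin.succ = A.assign (past ++ [s]) l := by
    funext i
    simp [assign]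
  rw [bins, Fin.univ_succ, Finset.cons_eq_insert, Finset.image_insert, Finset.map_eq_image,
    Finset.image_image]
  exact congrArg₂ insert (by simp [assign]) (congrArg (Finset.univ.image ·) hsucc)

lemma bins_append : A.bins past (l ++ l') = A.bins past l ∪ A.bins (past ++ l) l' := by
  induction l generalizing past with
  | nil => simp [bins_nil]
  | cons s l ih => simp [bins_cons, ih]

lemma content_nil : A.content past [] b = 0 := rfl

lemma content_cons : A.content past (s :: l) b =
    (if A.bin past s = b then {s} else 0) + A.content (past ++ [s]) l b := by
  simp [content, Fin.sum_univ_succ, assign]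
  rfl

lemma content_append :
    A.content past (l ++ l') b = A.content past l b + A.content (past ++ l) l' b := by
  induction l generalizing past with
  | nil => simp [content_nil]
  | cons s l ih => simp [content_cons, ih, add_assoc]

variable {A past l s b}

lemma content_eq_zero (hb : b ∉ A.bins past l) : A.content past l b = 0 :=
  Finset.sum_eq_zero fun i _ => if_neg fun hi => hb (Finset.mem_image.2 ⟨i, Finset.mem_univ i, hi⟩)

lemma exists_mem_content (hb : b ∈ A.bins past l) : ∃ s ∈ l, s ∈ A.content past l b := by
  obtain ⟨i, -, hi⟩ := Finset.mem_image.1 hb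
  exact ⟨l.get i, l.get_mem i, Multiset.mem_sum.2 ⟨i, Finset.mem_univ i, by simp [hi]⟩⟩

lemma sum_content {S : Finset ℕ} (hS : A.bins past l ⊆ S) : ∑ b ∈ S, A.content past l b = l := by
  have hmem (i : Fin l.length) : A.assign past l i ∈ S :=
    hS (Finset.mem_image_of_mem _ (Finset.mem_univ i))
  simp only [content]
  rw [Finset.sum_comm]
  simp only [Finset.sum_ite_eq, hmem, if_true]
  rw [← map_univ_val_eq_sum, Fin.univ_val_map, List.ofFn_get]

lemma sum_card_content {S : Finset ℕ} (hS : A.bins past l ⊆ S) :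
    ∑ b ∈ S, (A.content past l b).card = l.length := by
  rw [← Multiset.card_sum, sum_content hS, Multiset.coe_card]

lemma mem_of_mem_content (hs : s ∈ A.content past l b) : s ∈ l := by
  rw [← Multiset.mem_coe, ← sum_content (Finset.subset_insert b (A.bins past l))]
  exact Multiset.mem_sum.2 ⟨b, Finset.mem_insert_self _ _, hs⟩

variable (A b)

lemma packs_content (I : List Item) : Packs 1 1 (A.content [] I b) := by
  have hsub : A.content [] I b =
      Finset.univ.val.map fun i : {i // A.assign [] I i = b} => I.get i.1 := by
    rw [content, ← Finset.sum_filter, map_univ_val_eq_sum]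
    exact Finset.sum_subtype _ (by simp) _
  rw [hsub, packs_map_univ_iff, ← fits_iff_fitsIn]
  exact A.isPacking I b

/-- The bins used for `P` that receive another item when `l` is presented after `P`. -/
def reusedBins (P l : List Item) : Finset ℕ := A.bins [] P ∩ A.bins P l

lemma reusedBins_subset (P l : List Item) : A.reusedBins P l ⊆ A.bins [] P :=
  Finset.inter_subset_left

/-- The bins that are opened when `l` is presented after `P`. -/
def newBins (P l : List Item) : Finset ℕ := A.bins P l \ A.bins [] P

lemma card_bins_append_add_card_reusedBins (P l : List Item) :
    (A.bins [] (P ++ l)).card + (A.reusedBins P l).card =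
      (A.bins [] P).card + (A.bins P l).card := by
  rw [bins_append, List.nil_append]
  exact Finset.card_union_add_card_inter _ _

lemma card_bins_append (P l : List Item) :
    (A.bins [] (P ++ l)).card = (A.bins [] P).card + (A.newBins P l).card := by
  rw [bins_append, List.nil_append, newBins, ← Finset.union_sdiff_self_eq_union,
    Finset.card_union_of_disjoint Finset.disjoint_sdiff]

variable {P : List Item} {u : Item} {M : ℕ}

lemma card_bins_replicate (hu : 1 / 2 < side u) : (A.bins P (.replicate M u)).card = M := by
  have hone (b : ℕ) : (A.content P (.replicate M u) b).card ≤ 1 := by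
    have hpacks : Packs 1 1 (A.content P (.replicate M u) b) :=
      (A.packs_content b (P ++ .replicate M u)).of_le <| by
        rw [content_append, List.nil_append]
        exact le_add_self
    simpa using hpacks.card_mul_sq_le (k := 2) (c := 1) fun s hs => by
      rw [List.eq_of_mem_replicate (mem_of_mem_content hs)]
      push_cast
      linarith
  refine le_antisymm (Finset.card_image_le.trans_eq (by simp)) ?_
  calc M = ∑ b ∈ A.bins P (.replicate M u), (A.content P (.replicate M u) b).card := by
        rw [sum_card_content subset_rfl, List.length_replicate]
    _ ≤ (A.bins P (.replicate M u)).card := by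
        simpa using Finset.sum_le_card_nsmul _ _ 1 fun b _ => hone b

variable {A b}

lemma packs_content_add_of_mem_reusedBins (hb : b ∈ A.reusedBins P (.replicate M u)) :
    Packs 1 1 (A.content [] P b + {u}) := by
  obtain ⟨s, hs, hsb⟩ := exists_mem_content (Finset.mem_inter.1 hb).2
  rw [List.eq_of_mem_replicate hs] at hsb
  refine (A.packs_content b (P ++ .replicate M u)).of_le ?_
  rw [content_append, List.nil_append]
  gcongr
  exact Multiset.singleton_le.2 hsb

end OnlineAlgorithm

/-- The items of `m` that cannot share a bin with `u`. -/
noncomputable def conflicting (u : Item) (m : Multiset Item) : Multiset Item :=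
  m.filter fun s => 1 < side s + side u

/-- The items of `m` that can share a bin with `u` when nothing else is in that bin. -/
noncomputable def compatible (u : Item) (m : Multiset Item) : Multiset Item :=
  m.filter fun s => ¬ 1 < side s + side u

lemma compatible_add_conflicting (u : Item) (m : Multiset Item) :
    compatible u m + conflicting u m = m := by
  rw [add_comm]
  exact Multiset.filter_add_not _ m

lemma card_compatible_add_card_conflicting (u : Item) (m : Multiset Item) :
    (compatible u m).card + (conflicting u m).card = m.card := by
  rw [← Multiset.card_add, compatible_add_conflicting]

lemma mem_of_mem_conflicting {s u : Item} {m : Multiset Item} (hs : s ∈ conflicting u m) : s ∈ m :=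
  Multiset.mem_of_mem_filter hs

lemma side_le_of_mem_compatible {s u : Item} {m : Multiset Item} (hs : s ∈ compatible u m) :
    side s ≤ 1 - side u :=
  le_sub_iff_add_le.2 (not_lt.1 (Multiset.mem_filter.1 hs).2)

namespace OnlineAlgorithm

/-- The items of `X`, presented after `P`, that open a bin are the ones that conflict with `u`,
at least one for each new bin and altogether as many as new bins. An adversary achieves this by
choosing sides adaptively, and afterwards `u` fits into none of the new bins. -/
structure BlocksNewBins (A : OnlineAlgorithm) (P X : List Item) (u : Item) : Prop where
  card_conflicting : (conflicting u X).card = (A.newBins P X).card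
  exists_conflicting : ∀ b ∈ A.newBins P X, ∃ s ∈ A.content P X b, 1 < side s + side u

namespace BlocksNewBins

variable {A : OnlineAlgorithm} {P X : List Item} {s u : Item}

lemma cons_of_mem (H : A.BlocksNewBins (P ++ [s]) X u) (hb : A.bin P s ∈ A.bins [] P)
    (hs : side s + side u ≤ 1) : A.BlocksNewBins P (s :: X) u := by
  have hnew : A.newBins P (s :: X) = A.newBins (P ++ [s]) X := by
    simp [newBins, bins_append, bins_cons, bins_nil, hb, Finset.insert_sdiff_of_mem,
      Finset.union_eq_left.2]
  constructor
  · rw [hnew, ← H.card_conflicting]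
    simp [conflicting, not_lt.2 hs]
  · intro b hbX
    obtain ⟨t, ht, htu⟩ := H.exists_conflicting b (hnew ▸ hbX)
    exact ⟨t, by rw [content_cons]; exact Multiset.mem_add.2 (.inr ht), htu⟩

lemma cons_of_notMem (H : A.BlocksNewBins (P ++ [s]) X u) (hb : A.bin P s ∉ A.bins [] P)
    (hs : 1 < side s + side u) : A.BlocksNewBins P (s :: X) u := by
  have hnew : A.newBins P (s :: X) = insert (A.bin P s) (A.newBins (P ++ [s]) X) := by
    ext b
    by_cases h : b = A.bin P s <;> simp [newBins, bins_append, bins_cons, bins_nil, h, hb]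
  constructor
  · have hfresh : A.bin P s ∉ A.newBins (P ++ [s]) X := by
      simp [newBins, bins_append, bins_cons]
    rw [hnew, Finset.card_insert_of_notMem hfresh, ← H.card_conflicting]
    simp [conflicting, hs]
  · intro b hbX
    rw [hnew, Finset.mem_insert] at hbX
    rcases hbX with rfl | hbX
    · exact ⟨s, by simp [content_cons], hs⟩
    · obtain ⟨t, ht, htu⟩ := H.exists_conflicting b hbX
      exact ⟨t, by rw [content_cons]; exact Multiset.mem_add.2 (.inr ht), htu⟩

lemma mem_bins_of_packs (H : A.BlocksNewBins P X u) {b : ℕ} (hb : b ∈ A.bins [] (P ++ X))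
    (hpacks : Packs 1 1 (A.content [] (P ++ X) b + {u})) : b ∈ A.bins [] P := by
  by_contra hbP
  rw [bins_append, List.nil_append, Finset.mem_union, or_iff_right hbP] at hb
  obtain ⟨s, hs, hsu⟩ := H.exists_conflicting b (Finset.mem_sdiff.2 ⟨hb, hbP⟩)
  rw [content_append, List.nil_append] at hpacks
  exact (hpacks.side_add_side_le (Multiset.mem_add.2 (.inr hs))).not_gt hsu

end BlocksNewBins

/-- The adversary halves the interval of admissible sides after each item: the next items are
smaller than an item that opened a bin, and larger than one that did not. -/
lemma exists_blocksNewBins (A : OnlineAlgorithm) (P : List Item) (N : ℕ) {lo hi : ℝ}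
    (hlo : 0 ≤ lo) (hlohi : lo < hi) (hhi : hi ≤ 1) :
    ∃ X u, X.length = N ∧ (∀ s ∈ X, side s ∈ Set.Ioo lo hi) ∧
      side u ∈ Set.Ioo (1 - hi) (1 - lo) ∧ A.BlocksNewBins P X u := by
  induction N generalizing P lo hi with
  | zero =>
    obtain ⟨u, hu⟩ := exists_item_side_mem_Ioo (sub_nonneg.2 hhi) (sub_lt_sub_left hlohi 1)
      (sub_le_self 1 hlo)
    exact ⟨[], u, rfl, by simp, hu, by simp [conflicting, newBins, bins_nil],
      by simp [newBins, bins_nil]⟩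
  | succ N ih =>
    obtain ⟨s, hslo, hshi⟩ := exists_item_side_mem_Ioo hlo hlohi hhi
    by_cases hb : A.bin P s ∈ A.bins [] P
    · obtain ⟨X, u, hlen, hX, ⟨hu, hu'⟩, H⟩ := ih (P ++ [s]) (hlo.trans hslo.le) hshi hhi
      refine ⟨s :: X, u, by simp [hlen], List.forall_mem_cons.2 ⟨⟨hslo, hshi⟩, fun t ht =>
        ⟨hslo.trans (hX t ht).1, (hX t ht).2⟩⟩, ⟨hu, by linarith⟩, H.cons_of_mem hb (by linarith)⟩
    · obtain ⟨X, u, hlen, hX, ⟨hu, hu'⟩, H⟩ := ih (P ++ [s]) hlo hslo (hshi.le.trans hhi)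
      refine ⟨s :: X, u, by simp [hlen], List.forall_mem_cons.2 ⟨⟨hslo, hshi⟩, fun t ht =>
        ⟨(hX t ht).1, (hX t ht).2.trans hshi⟩⟩, ⟨by linarith, hu'⟩,
        H.cons_of_notMem hb (by linarith)⟩

end OnlineAlgorithm

/-- An item of side slightly below `1 / 12`. -/
def IsSmall (s : Item) : Prop := side s ∈ Set.Ioc (1 / 13) (2 / 25)

/-- An item of side slightly above `1 / 4`. -/
def IsQuarter (s : Item) : Prop := side s ∈ Set.Ioo (1 / 4) (2501 / 10000)

/-- An item of side slightly above `1 / 3`. -/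
def IsThird (s : Item) : Prop := side s ∈ Set.Ioo (1 / 3) (3334 / 10000)

/-- An item of side slightly below `3 / 4`. -/
def IsThreeQuarters (s : Item) : Prop := side s ∈ Set.Ico (7499 / 10000) (3 / 4)

/-- An item of side slightly below `2 / 3`. -/
def IsTwoThirds (s : Item) : Prop := side s ∈ Set.Ico (6666 / 10000) (2 / 3)

section Capacity

variable {n q t : Multiset Item} {u : Item}

lemma card_le_gridLoad_small (hn : ∀ s ∈ n, IsSmall s) : n.card ≤ gridLoad 13 n := by
  simpa using sq_mul_card_le_gridLoad (k := 13) (c := 1) fun s hs => by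
    push_cast
    linarith [(hn s hs).1]

lemma card_le_gridLoad_quarter (hq : ∀ s ∈ q, IsQuarter s) :
    9 * q.card ≤ gridLoad 13 q ∧ q.card ≤ gridLoad 4 q := by
  constructor
  · exact sq_mul_card_le_gridLoad (k := 13) (c := 3) fun s hs => by
      push_cast
      linarith [(hq s hs).1]
  · simpa using sq_mul_card_le_gridLoad (k := 4) (c := 1) fun s hs => by
      push_cast
      linarith [(hq s hs).1]

lemma card_le_gridLoad_third (ht : ∀ s ∈ t, IsThird s) :
    16 * t.card ≤ gridLoad 13 t ∧ t.card ≤ gridLoad 4 t ∧ t.card ≤ gridLoad 3 t := by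
  refine ⟨sq_mul_card_le_gridLoad (k := 13) (c := 4) fun s hs => ?_, ?_, ?_⟩
  · push_cast
    linarith [(ht s hs).1]
  · simpa using sq_mul_card_le_gridLoad (k := 4) (c := 1) fun s hs => by
      push_cast
      linarith [(ht s hs).1]
  · simpa using sq_mul_card_le_gridLoad (k := 3) (c := 1) fun s hs => by
      push_cast
      linarith [(ht s hs).1]

lemma sq_le_gridLoad_singleton {k c : ℕ} (hu : (c : ℝ) < k * side u) :
    c ^ 2 ≤ gridLoad k {u} := by
  simpa using sq_mul_card_le_gridLoad (m := {u}) (by simpa using hu)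

lemma Packs.card_le (H : Packs 1 1 (n + q + t)) (hn : ∀ s ∈ n, IsSmall s)
    (hq : ∀ s ∈ q, IsQuarter s) (ht : ∀ s ∈ t, IsThird s) :
    n.card + 9 * q.card + 16 * t.card ≤ 144 ∧ q.card + t.card ≤ 9 ∧ t.card ≤ 4 := by
  have h₁₃ := H.gridLoad_le 13
  have h₄ := H.gridLoad_le 4
  have h₃ := H.gridLoad_le 3
  simp only [gridLoad_add] at h₁₃ h₄ h₃
  have := card_le_gridLoad_small hn
  have := card_le_gridLoad_quarter hq
  have := card_le_gridLoad_third ht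
  omega

lemma Packs.card_le_of_isThreeQuarters (H : Packs 1 1 (n + q + {u})) (hn : ∀ s ∈ n, IsSmall s)
    (hq : ∀ s ∈ q, IsQuarter s) (hu : IsThreeQuarters u) :
    n.card + 9 * q.card ≤ 63 ∧ q.card ≤ 5 := by
  have h₁₃ := H.gridLoad_le 13
  have h₄ := H.gridLoad_le 4
  simp only [gridLoad_add] at h₁₃ h₄
  have hu₁₃ : 9 ^ 2 ≤ gridLoad 13 {u} :=
    sq_le_gridLoad_singleton (by push_cast; linarith [hu.1])
  have hu₄ : 2 ^ 2 ≤ gridLoad 4 {u} := sq_le_gridLoad_singleton (by push_cast; linarith [hu.1])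
  have := card_le_gridLoad_small hn
  have := card_le_gridLoad_quarter hq
  omega

lemma Packs.card_le_of_isTwoThirds (H : Packs 1 1 (n + q + t + {u})) (hn : ∀ s ∈ n, IsSmall s)
    (hq : ∀ s ∈ q, IsQuarter s) (ht : ∀ s ∈ t, IsThird s) (hu : IsTwoThirds u) :
    n.card + 9 * q.card + 16 * t.card ≤ 80 ∧ q.card + t.card ≤ 5 ∧ t.card ≤ 3 := by
  have h₁₃ := H.gridLoad_le 13
  have h₄ := H.gridLoad_le 4
  have h₃ := H.gridLoad_le 3
  simp only [gridLoad_add] at h₁₃ h₄ h₃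
  have hu₁₃ : 8 ^ 2 ≤ gridLoad 13 {u} :=
    sq_le_gridLoad_singleton (by push_cast; linarith [hu.1])
  have hu₄ : 2 ^ 2 ≤ gridLoad 4 {u} := sq_le_gridLoad_singleton (by push_cast; linarith [hu.1])
  have hu₃ : 1 ^ 2 ≤ gridLoad 3 {u} := sq_le_gridLoad_singleton (by push_cast; linarith [hu.1])
  have := card_le_gridLoad_small hn
  have := card_le_gridLoad_quarter hq
  have := card_le_gridLoad_third ht
  omega

end Capacity

section Layouts

variable {n q t : Multiset Item} {u : Item}

/-- The square `u` in a corner leaves an L-shape, which is cut into a strip beside `u` and a strip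
along the whole bin. -/
lemma Packs.corner {r₁ r₂ : Multiset Item} (hu : side u ≤ 1)
    (H₁ : Packs (1 - side u) (side u) r₁) (H₂ : Packs 1 (1 - side u) r₂) :
    Packs 1 1 ({u} + r₁ + r₂) := by
  have hcorner : Packs (side u) (side u) {u} := of_card_le_one (by simp) (by simp) (by simp)
  have hlow := (beside (side_pos u).le (sub_nonneg.2 hu) hcorner H₁).mono (w' := 1) (by linarith)
    le_rfl
  exact (above (side_pos u).le (sub_nonneg.2 hu) hlow H₂).mono le_rfl (by linarith)

lemma packs_threeQuarters_quarters (hu : IsThreeQuarters u) (hq : ∀ s ∈ q, side s ≤ 1 - side u)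
    (hn : ∀ s ∈ n, IsSmall s) (cq : q.card ≤ 5) (cn : n.card ≤ 15) :
    Packs 1 1 ({u} + (q + n)) := by
  obtain ⟨hu₁, hu₂⟩ := hu
  have hσ : 0 ≤ 1 - side u := by linarith
  obtain ⟨q₁, q₂, rfl, cq₁, cq₂⟩ := exists_add_eq_of_card_le (a := 2) (b := 3) cq
  obtain ⟨n₁, n₂, rfl, cn₁, cn₂⟩ := exists_add_eq_of_card_le (a := 6) (b := 9) cn
  simp only [Multiset.mem_add, or_imp, forall_and] at hq hn
  have beside_q : Packs (1 - side u) (2 * (1 - side u)) q₁ :=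
    .block hσ 1 2 hq.1 cq₁ (by simp) (by simp)
  have beside_n : Packs (1 - side u) (4 / 25) n₁ :=
    .block (by norm_num) 3 2 (fun s hs => (hn.1 s hs).2) cn₁ (by push_cast; linarith) (by norm_num)
  have above_q : Packs (3 * (1 - side u)) (1 - side u) q₂ :=
    .block hσ 3 1 hq.2 cq₂ (by simp) (by simp)
  have above_n : Packs (6 / 25) (1 - side u) n₂ :=
    .block (by norm_num) 3 3 (fun s hs => (hn.2 s hs).2) cn₂ (by norm_num) (by push_cast; linarith)
  convert Packs.corner (by linarith)
    ((Packs.above (by linarith) (by norm_num) beside_q beside_n).mono le_rfl (by linarith))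
    ((Packs.beside (by linarith) (by norm_num) above_q above_n).mono (by linarith) le_rfl) using 1
  abel

lemma packs_twoThirds_thirds (hu : IsTwoThirds u) (ht : ∀ s ∈ t, side s ≤ 1 - side u)
    (hq : ∀ s ∈ q, IsQuarter s) (hn : ∀ s ∈ n, IsSmall s) (ct : t.card ≤ 3) (cq : q.card ≤ 2)
    (cn : n.card ≤ 6) : Packs 1 1 ({u} + (t + q + n)) := by
  obtain ⟨hu₁, hu₂⟩ := hu
  have hσ : 0 ≤ 1 - side u := by linarith
  obtain ⟨t₁, t₂, rfl, ct₁, ct₂⟩ := exists_add_eq_of_card_le (a := 1) (b := 2) ct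
  obtain ⟨q₁, q₂, rfl, cq₁, cq₂⟩ := exists_add_eq_of_card_le (a := 1) (b := 1) cq
  obtain ⟨n₁, n₂, rfl, cn₁, cn₂⟩ := exists_add_eq_of_card_le (a := 3) (b := 3) cn
  simp only [Multiset.mem_add, or_imp, forall_and] at ht hq hn
  have beside_t : Packs (1 - side u) (1 - side u) t₁ := .block hσ 1 1 ht.1 ct₁ (by simp) (by simp)
  have beside_q : Packs (1 - side u) (2501 / 10000) q₁ :=
    .block (by norm_num) 1 1 (fun s hs => (hq.1 s hs).2.le) cq₁ (by push_cast; linarith) (by simp)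
  have beside_n : Packs (1 - side u) (2 / 25) n₁ :=
    .block (by norm_num) 3 1 (fun s hs => (hn.1 s hs).2) cn₁ (by push_cast; linarith) (by simp)
  have above_t : Packs (2 * (1 - side u)) (1 - side u) t₂ :=
    .block hσ 2 1 ht.2 ct₂ (by simp) (by simp)
  have above_q : Packs (2501 / 10000) (1 - side u) q₂ :=
    .block (by norm_num) 1 1 (fun s hs => (hq.2 s hs).2.le) cq₂ (by simp) (by push_cast; linarith)
  have above_n : Packs (2 / 25) (1 - side u) n₂ :=
    .block (by norm_num) 1 3 (fun s hs => (hn.2 s hs).2) cn₂ (by simp) (by push_cast; linarith)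
  convert Packs.corner (by linarith)
    ((Packs.above (by linarith) (by norm_num) beside_t <|
      .above (by norm_num) (by norm_num) beside_q beside_n).mono le_rfl (by linarith))
    ((Packs.beside (by linarith) (by norm_num) above_t <|
      .beside (by norm_num) (by norm_num) above_q above_n).mono (by linarith) le_rfl) using 1
  abel

lemma packs_quarters (hq : ∀ s ∈ q, IsQuarter s) (hn : ∀ s ∈ n, IsSmall s) (cq : q.card ≤ 9)
    (cn : n.card ≤ 27) : Packs 1 1 (q + n) := by
  have block_q : Packs (7503 / 10000) 1 q :=
    .block (by norm_num) 3 3 (fun s hs => (hq s hs).2.le) cq (by norm_num) (by norm_num)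
  have block_n : Packs (6 / 25) 1 n :=
    .block (by norm_num) 3 12 (fun s hs => (hn s hs).2) (by omega) (by norm_num) (by norm_num)
  exact (Packs.beside (by norm_num) (by norm_num) block_q block_n).mono (by norm_num) le_rfl

lemma packs_thirds (ht : ∀ s ∈ t, IsThird s) (hq : ∀ s ∈ q, IsQuarter s) (hn : ∀ s ∈ n, IsSmall s)
    (ct : t.card ≤ 4) (cq : q.card ≤ 3) (cn : n.card ≤ 8) : Packs 1 1 (t + q + n) := by
  obtain ⟨q₁, q₂, rfl, cq₁, cq₂⟩ := exists_add_eq_of_card_le (a := 2) (b := 1) cq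
  simp only [Multiset.mem_add, or_imp, forall_and] at hq
  have corner_t : Packs (6668 / 10000) (6668 / 10000) t :=
    .block (by norm_num) 2 2 (fun s hs => (ht s hs).2.le) ct (by norm_num) (by norm_num)
  have beside_q : Packs (2501 / 10000) (6668 / 10000) q₁ :=
    .block (by norm_num) 1 2 (fun s hs => (hq.1 s hs).2.le) cq₁ (by norm_num) (by norm_num)
  have beside_n : Packs (2 / 25) (6668 / 10000) n :=
    .block (by norm_num) 1 8 (fun s hs => (hn s hs).2) cn (by norm_num) (by norm_num)
  have above_q : Packs 1 (2501 / 10000) q₂ :=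
    .block (by norm_num) 1 1 (fun s hs => (hq.2 s hs).2.le) cq₂ (by norm_num) (by norm_num)
  have low : Packs 1 (6668 / 10000) (t + (q₁ + n)) :=
    (Packs.beside (by norm_num) (by norm_num) corner_t <|
      .beside (by norm_num) (by norm_num) beside_q beside_n).mono (by norm_num) le_rfl
  convert (Packs.above (by norm_num) (by norm_num) low above_q).mono (h' := 1) le_rfl
    (by norm_num) using 1
  abel

lemma packs_small (hn : ∀ s ∈ n, IsSmall s) (cn : n.card ≤ 144) : Packs 1 1 n :=
  .block (by norm_num) 12 12 (fun s hs => (hn s hs).2) cn (by norm_num) (by norm_num)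

end Layouts

section Offline

variable {n q t : Multiset Item} {u : Item} {k : ℕ}

lemma packIn_threeQuarters_quarters (hu : IsThreeQuarters u) (hq : ∀ s ∈ q, side s ≤ 1 - side u)
    (hn : ∀ s ∈ n, IsSmall s) (cq : q.card ≤ 5 * k) (cn : n.card ≤ 15 * k) :
    PackIn k (.replicate k u + (q + n)) := by
  obtain ⟨q', rfl, cq'⟩ := exists_sum_eq_of_card_le cq
  obtain ⟨n', rfl, cn'⟩ := exists_sum_eq_of_card_le cn
  simp only [Multiset.mem_sum, Finset.mem_univ, true_and, forall_exists_index] at hq hn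
  exact ⟨fun i => {u} + (q' i + n' i), by
    simp only [Finset.sum_add_distrib, Finset.sum_const, Finset.card_fin, Multiset.nsmul_singleton],
    fun i => packs_threeQuarters_quarters hu (hq · i) (hn · i) (cq' i) (cn' i)⟩

lemma packIn_twoThirds_thirds (hu : IsTwoThirds u) (ht : ∀ s ∈ t, side s ≤ 1 - side u)
    (hq : ∀ s ∈ q, IsQuarter s) (hn : ∀ s ∈ n, IsSmall s) (ct : t.card ≤ 3 * k)
    (cq : q.card ≤ 2 * k) (cn : n.card ≤ 6 * k) :
    PackIn k (.replicate k u + (t + q + n)) := by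
  obtain ⟨t', rfl, ct'⟩ := exists_sum_eq_of_card_le ct
  obtain ⟨q', rfl, cq'⟩ := exists_sum_eq_of_card_le cq
  obtain ⟨n', rfl, cn'⟩ := exists_sum_eq_of_card_le cn
  simp only [Multiset.mem_sum, Finset.mem_univ, true_and, forall_exists_index] at ht hq hn
  exact ⟨fun i => {u} + (t' i + q' i + n' i), by
    simp only [Finset.sum_add_distrib, Finset.sum_const, Finset.card_fin, Multiset.nsmul_singleton],
    fun i => packs_twoThirds_thirds hu (ht · i) (hq · i) (hn · i) (ct' i) (cq' i) (cn' i)⟩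

lemma packIn_quarters (hq : ∀ s ∈ q, IsQuarter s) (hn : ∀ s ∈ n, IsSmall s)
    (cq : q.card ≤ 9 * k) (cn : n.card ≤ 27 * k) : PackIn k (q + n) := by
  obtain ⟨q', rfl, cq'⟩ := exists_sum_eq_of_card_le cq
  obtain ⟨n', rfl, cn'⟩ := exists_sum_eq_of_card_le cn
  simp only [Multiset.mem_sum, Finset.mem_univ, true_and, forall_exists_index] at hq hn
  exact ⟨fun i => q' i + n' i, Finset.sum_add_distrib,
    fun i => packs_quarters (hq · i) (hn · i) (cq' i) (cn' i)⟩

lemma packIn_thirds (ht : ∀ s ∈ t, IsThird s) (hq : ∀ s ∈ q, IsQuarter s)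
    (hn : ∀ s ∈ n, IsSmall s) (ct : t.card ≤ 4 * k) (cq : q.card ≤ 3 * k)
    (cn : n.card ≤ 8 * k) : PackIn k (t + q + n) := by
  obtain ⟨t', rfl, ct'⟩ := exists_sum_eq_of_card_le ct
  obtain ⟨q', rfl, cq'⟩ := exists_sum_eq_of_card_le cq
  obtain ⟨n', rfl, cn'⟩ := exists_sum_eq_of_card_le cn
  simp only [Multiset.mem_sum, Finset.mem_univ, true_and, forall_exists_index] at ht hq hn
  exact ⟨fun i => t' i + q' i + n' i, by simp [Finset.sum_add_distrib],
    fun i => packs_thirds (ht · i) (hq · i) (hn · i) (ct' i) (cq' i) (cn' i)⟩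

lemma packIn_small (hn : ∀ s ∈ n, IsSmall s) (cn : n.card ≤ 144 * k) : PackIn k n := by
  obtain ⟨n', rfl, cn'⟩ := exists_sum_eq_of_card_le cn
  simp only [Multiset.mem_sum, Finset.mem_univ, true_and, forall_exists_index] at hn
  exact ⟨n', rfl, fun i => packs_small (hn · i) (cn' i)⟩

lemma packIn_quarters_add_replicate {l : ℕ} {q₁ q₂ : Multiset Item} (hu : IsThreeQuarters u)
    (hq₁ : ∀ s ∈ q₁, side s ≤ 1 - side u) (hq₂ : ∀ s ∈ q₂, IsQuarter s) (hn : ∀ s ∈ n, IsSmall s)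
    (cq₁ : q₁.card ≤ 5 * k) (cq₂ : q₂.card ≤ 9 * l) (cn : n.card ≤ 15 * k + 27 * l) :
    PackIn (k + l) (n + (q₁ + q₂) + .replicate k u) := by
  obtain ⟨n₁, n₂, rfl, cn₁, cn₂⟩ := exists_add_eq_of_card_le cn
  simp only [Multiset.mem_add, or_imp, forall_and] at hn
  convert (packIn_threeQuarters_quarters hu hq₁ hn.1 cq₁ cn₁).add
    (packIn_quarters hq₂ hn.2 cq₂ cn₂) using 1
  abel

lemma packIn_thirds_add_replicate {l : ℕ} {t₁ t₂ : Multiset Item} (hu : IsTwoThirds u)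
    (ht₁ : ∀ s ∈ t₁, side s ≤ 1 - side u) (ht₂ : ∀ s ∈ t₂, IsThird s) (hq : ∀ s ∈ q, IsQuarter s)
    (hn : ∀ s ∈ n, IsSmall s) (ct₁ : t₁.card ≤ 3 * k) (ct₂ : t₂.card ≤ 4 * l)
    (cq : q.card ≤ 2 * k + 3 * l) (cn : n.card ≤ 6 * k + 8 * l) :
    PackIn (k + l) (n + q + (t₁ + t₂) + .replicate k u) := by
  obtain ⟨q₁, q₂, rfl, cq₁, cq₂⟩ := exists_add_eq_of_card_le cq
  obtain ⟨n₁, n₂, rfl, cn₁, cn₂⟩ := exists_add_eq_of_card_le cn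
  simp only [Multiset.mem_add, or_imp, forall_and] at hq hn
  convert (packIn_twoThirds_thirds hu ht₁ hq.1 hn.1 ct₁ cq₁ cn₁).add
    (packIn_thirds ht₂ hq.2 hn.2 ct₂ cq₂ cn₂) using 1
  abel

end Offline

/-- The weights `4`, `32`, `27` of the items and `168`, `28`, `100` of the reused bins form a
solution of the dual of the linear program that minimises the competitive ratio against the
adversary below. -/
lemma weight_le {a q t b : ℕ} {B₀ B₁ C D E : Finset ℕ} (hB : B₀ ⊆ B₁)
    (hcap : a + 9 * q + 16 * t ≤ 144 ∧ q + t ≤ 9 ∧ t ≤ 4)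
    (ha : b ∉ B₀ → a = 0) (hq : b ∉ B₁ → q = 0)
    (hC : b ∈ C → b ∈ B₀ ∧ a + 9 * q ≤ 63 ∧ q ≤ 5)
    (hD : b ∈ D → a + 9 * q + 16 * t ≤ 80 ∧ q + t ≤ 5 ∧ t ≤ 3)
    (hE : b ∈ E → b ∈ B₁ ∧ a + 9 * q + 16 * t ≤ 80 ∧ q + t ≤ 5 ∧ t ≤ 3) :
    4 * a + 32 * q + 27 * t + 168 * (if b ∈ C then 1 else 0) + 28 * (if b ∈ D then 1 else 0) +
        100 * (if b ∈ E then 1 else 0) ≤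
      109 + 179 * (if b ∈ B₁ then 1 else 0) + 288 * (if b ∈ B₀ then 1 else 0) := by
  have h₀₁ : b ∈ B₀ → b ∈ B₁ := fun h => hB h
  split_ifs <;> simp_all <;> omega

namespace OnlineAlgorithm

lemma card_bins_le_of_packIn {A : OnlineAlgorithm} {R c : ℝ} {k : ℕ} {I : List Item} (hR : 0 ≤ R)
    (hcost : A.cost I + c ≤ R * opt I) (H : PackIn k I) : (A.bins [] I).card + c ≤ R * k :=
  hcost.trans (by gcongr; exact H.opt_le)

lemma card_bins_add_le_of_packIn {A : OnlineAlgorithm} {R c : ℝ} {k M : ℕ} {P : List Item}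
    {u : Item} (hR : 0 ≤ R) (hu : 1 / 2 < side u)
    (hcost : A.cost (P ++ .replicate M u) + c ≤ R * opt (P ++ .replicate M u))
    (H : PackIn k ↑(P ++ .replicate M u)) :
    (A.bins [] P).card + M + c ≤ R * k + (A.reusedBins P (.replicate M u)).card := by
  have hcard := A.card_bins_append_add_card_reusedBins P (.replicate M u)
  rw [A.card_bins_replicate hu] at hcard
  rify at hcard
  linarith [card_bins_le_of_packIn hR hcost H]

/-- The three phases of an adversary against `A` for the scale `K`: it presents the small items
`Z`, then adaptively the quarters `X`, and then adaptively the thirds `Y`. It can stop after a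
phase with copies of a large item: `u` after `X`, and `v` or `w` after `Y`. -/
structure Adversary (A : OnlineAlgorithm) (K : ℕ) where
  (Z X Y : List Item)
  (u v w : Item)
  length_Z : Z.length = 6 * K
  length_X : X.length = 2 * K
  length_Y : Y.length = 3 * K
  small : ∀ s ∈ Z, IsSmall s
  quarter : ∀ s ∈ X, IsQuarter s
  third : ∀ s ∈ Y, IsThird s
  threeQuarters : IsThreeQuarters u
  twoThirds_v : IsTwoThirds v
  twoThirds_w : IsTwoThirds w
  third_le : ∀ s ∈ Y, side s ≤ 1 - side v
  blocks_X : A.BlocksNewBins Z X u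
  blocks_Y : A.BlocksNewBins (Z ++ X) Y w

namespace Adversary

lemma nonempty (A : OnlineAlgorithm) (K : ℕ) : Nonempty (A.Adversary K) := by
  obtain ⟨z, hz⟩ := exists_item_side_mem_Ioo (a := 1 / 13) (b := 2 / 25) (by norm_num) (by norm_num)
    (by norm_num)
  obtain ⟨v, hv⟩ := exists_item_side_mem_Ioo (a := 6666 / 10000) (b := 66661 / 100000) (by norm_num)
    (by norm_num) (by norm_num)
  obtain ⟨X, u, hXlen, hX, hu, hXu⟩ := A.exists_blocksNewBins (.replicate (6 * K) z) (2 * K)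
    (lo := 1 / 4) (hi := 2501 / 10000) (by norm_num) (by norm_num) (by norm_num)
  obtain ⟨Y, w, hYlen, hY, hw, hYw⟩ := A.exists_blocksNewBins (.replicate (6 * K) z ++ X) (3 * K)
    (lo := 1 / 3) (hi := 33339 / 100000) (by norm_num) (by norm_num) (by norm_num)
  refine ⟨.replicate (6 * K) z, X, Y, u, v, w, List.length_replicate, hXlen, hYlen, fun s hs => ?_,
    hX, fun s hs => ⟨(hY s hs).1, ?_⟩, ⟨?_, ?_⟩, ⟨hv.1.le, ?_⟩, ⟨?_, ?_⟩, fun s hs => ?_, hXu, hYw⟩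
  · rw [List.eq_of_mem_replicate hs]
    exact ⟨hz.1, hz.2.le⟩
  · linarith [(hY s hs).2]
  · linarith [hu.1]
  · linarith [hu.2]
  · linarith [hv.2]
  · linarith [hw.1]
  · linarith [hw.2]
  · linarith [(hY s hs).2, hv.2]

variable {A : OnlineAlgorithm} {K : ℕ} (S : A.Adversary K)

lemma isSmall_of_mem_content {P : List Item} {b : ℕ} {s : Item} (hs : s ∈ A.content P S.Z b) :
    IsSmall s := S.small s (mem_of_mem_content hs)

lemma isQuarter_of_mem_content {P : List Item} {b : ℕ} {s : Item} (hs : s ∈ A.content P S.X b) :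
    IsQuarter s := S.quarter s (mem_of_mem_content hs)

lemma isThird_of_mem_content {P : List Item} {b : ℕ} {s : Item} (hs : s ∈ A.content P S.Y b) :
    IsThird s := S.third s (mem_of_mem_content hs)

lemma content_quarters (b : ℕ) :
    A.content [] (S.Z ++ S.X) b = A.content [] S.Z b + A.content S.Z S.X b := by
  rw [content_append, List.nil_append]

lemma content_thirds (b : ℕ) : A.content [] (S.Z ++ S.X ++ S.Y) b =
    A.content [] S.Z b + A.content S.Z S.X b + A.content (S.Z ++ S.X) S.Y b := by
  rw [content_append, List.nil_append, content_quarters]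

lemma mem_and_card_content_le_of_mem_reusedBins_u {b M : ℕ}
    (hb : b ∈ A.reusedBins (S.Z ++ S.X) (.replicate M S.u)) :
    b ∈ A.bins [] S.Z ∧
      (A.content [] S.Z b).card + 9 * (A.content S.Z S.X b).card ≤ 63 ∧
      (A.content S.Z S.X b).card ≤ 5 := by
  have hpacks := packs_content_add_of_mem_reusedBins hb
  refine ⟨S.blocks_X.mem_bins_of_packs (A.reusedBins_subset _ _ hb) hpacks, ?_⟩
  rw [content_quarters] at hpacks
  exact hpacks.card_le_of_isThreeQuarters (fun _ => S.isSmall_of_mem_content)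
    (fun _ => S.isQuarter_of_mem_content) S.threeQuarters

lemma card_content_le_of_mem_reusedBins {b M : ℕ} {x : Item} (hx : IsTwoThirds x)
    (hb : b ∈ A.reusedBins (S.Z ++ S.X ++ S.Y) (.replicate M x)) :
    (A.content [] S.Z b).card + 9 * (A.content S.Z S.X b).card +
        16 * (A.content (S.Z ++ S.X) S.Y b).card ≤ 80 ∧
      (A.content S.Z S.X b).card + (A.content (S.Z ++ S.X) S.Y b).card ≤ 5 ∧
      (A.content (S.Z ++ S.X) S.Y b).card ≤ 3 := by
  have hpacks := packs_content_add_of_mem_reusedBins hb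
  rw [content_thirds] at hpacks
  exact hpacks.card_le_of_isTwoThirds (fun _ => S.isSmall_of_mem_content)
    (fun _ => S.isQuarter_of_mem_content) (fun _ => S.isThird_of_mem_content) hx

lemma mem_bins_of_mem_reusedBins_w {b M : ℕ}
    (hb : b ∈ A.reusedBins (S.Z ++ S.X ++ S.Y) (.replicate M S.w)) :
    b ∈ A.bins [] (S.Z ++ S.X) :=
  S.blocks_Y.mem_bins_of_packs (A.reusedBins_subset _ _ hb)
    (packs_content_add_of_mem_reusedBins hb)

lemma card_content_le (b : ℕ) :
    (A.content [] S.Z b).card + 9 * (A.content S.Z S.X b).card +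
        16 * (A.content (S.Z ++ S.X) S.Y b).card ≤ 144 ∧
      (A.content S.Z S.X b).card + (A.content (S.Z ++ S.X) S.Y b).card ≤ 9 ∧
      (A.content (S.Z ++ S.X) S.Y b).card ≤ 4 := by
  have hpacks := A.packs_content b (S.Z ++ S.X ++ S.Y)
  rw [content_thirds] at hpacks
  exact hpacks.card_le (fun _ => S.isSmall_of_mem_content) (fun _ => S.isQuarter_of_mem_content)
    (fun _ => S.isThird_of_mem_content)

lemma card_reusedBins_le (M L N : ℕ) :
    4 * S.Z.length + 32 * S.X.length + 27 * S.Y.length +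
        168 * (A.reusedBins (S.Z ++ S.X) (.replicate M S.u)).card +
        28 * (A.reusedBins (S.Z ++ S.X ++ S.Y) (.replicate L S.v)).card +
        100 * (A.reusedBins (S.Z ++ S.X ++ S.Y) (.replicate N S.w)).card ≤
      109 * (A.bins [] (S.Z ++ S.X ++ S.Y)).card + 179 * (A.bins [] (S.Z ++ S.X)).card +
        288 * (A.bins [] S.Z).card := by
  have hB₁ : A.bins [] (S.Z ++ S.X) = A.bins [] S.Z ∪ A.bins S.Z S.X := bins_append ..
  have hB₂ : A.bins [] (S.Z ++ S.X ++ S.Y) = A.bins [] (S.Z ++ S.X) ∪ A.bins (S.Z ++ S.X) S.Y :=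
    bins_append ..
  have h₀₁ : A.bins [] S.Z ⊆ A.bins [] (S.Z ++ S.X) := hB₁ ▸ Finset.subset_union_left
  have h₁₂ : A.bins [] (S.Z ++ S.X) ⊆ A.bins [] (S.Z ++ S.X ++ S.Y) :=
    hB₂ ▸ Finset.subset_union_left
  have hX : A.bins S.Z S.X ⊆ A.bins [] (S.Z ++ S.X) := hB₁ ▸ Finset.subset_union_right
  have hY : A.bins (S.Z ++ S.X) S.Y ⊆ A.bins [] (S.Z ++ S.X ++ S.Y) :=
    hB₂ ▸ Finset.subset_union_right
  have hsum := Finset.sum_le_sum fun b (_ : b ∈ A.bins [] (S.Z ++ S.X ++ S.Y)) =>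
    weight_le h₀₁ (S.card_content_le b) (fun h => by rw [content_eq_zero h, Multiset.card_zero])
      (fun h => by rw [content_eq_zero fun h' => h (hX h'), Multiset.card_zero])
      (S.mem_and_card_content_le_of_mem_reusedBins_u (M := M))
      (S.card_content_le_of_mem_reusedBins S.twoThirds_v (M := L))
      (fun h => ⟨S.mem_bins_of_mem_reusedBins_w (M := N) h,
        S.card_content_le_of_mem_reusedBins S.twoThirds_w h⟩)
  have hcard {T : Finset ℕ} (hT : T ⊆ A.bins [] (S.Z ++ S.X ++ S.Y)) :
      ∑ b ∈ A.bins [] (S.Z ++ S.X ++ S.Y), (if b ∈ T then 1 else 0) = T.card := by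
    rw [Finset.sum_ite_mem, Finset.inter_eq_right.2 hT, Finset.card_eq_sum_ones]
  simpa only [Finset.sum_add_distrib, ← Finset.mul_sum, sum_card_content (h₀₁.trans h₁₂),
    sum_card_content (hX.trans h₁₂), sum_card_content hY, hcard h₁₂, hcard (h₀₁.trans h₁₂),
    hcard ((A.reusedBins_subset _ _).trans h₁₂), hcard (A.reusedBins_subset _ _),
    Finset.sum_const, smul_eq_mul, mul_comm _ 109] using hsum

lemma card_bins_quarters : (A.bins [] (S.Z ++ S.X)).card =
    (A.bins [] S.Z).card + (conflicting S.u S.X).card := by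
  rw [card_bins_append, S.blocks_X.card_conflicting]

lemma card_bins_thirds : (A.bins [] (S.Z ++ S.X ++ S.Y)).card =
    (A.bins [] (S.Z ++ S.X)).card + (conflicting S.w S.Y).card := by
  rw [card_bins_append, S.blocks_Y.card_conflicting]

lemma packIn_Z {k : ℕ} (hk : 6 * K ≤ 144 * k) : PackIn k S.Z :=
  packIn_small S.small (by simpa [S.length_Z])

lemma packIn_u {k l : ℕ} (hcomp : (compatible S.u S.X).card ≤ 5 * k)
    (hconf : (conflicting S.u S.X).card ≤ 9 * l) (hZ : 6 * K ≤ 15 * k + 27 * l) :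
    PackIn (k + l) ↑(S.Z ++ S.X ++ .replicate k S.u) := by
  have := packIn_quarters_add_replicate (n := S.Z) S.threeQuarters
    (fun _ => side_le_of_mem_compatible) (fun s hs => S.quarter s (mem_of_mem_conflicting hs))
    S.small hcomp hconf (by simpa [S.length_Z])
  rwa [compatible_add_conflicting] at this

lemma packIn_v : PackIn K ↑(S.Z ++ S.X ++ S.Y ++ .replicate K S.v) := by
  convert packIn_twoThirds_thirds (k := K) (n := S.Z) (q := S.X) (t := S.Y) S.twoThirds_v S.third_le
    S.quarter S.small (by simp [S.length_Y]) (by simp [S.length_X]) (by simp [S.length_Z]) using 1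
  simp only [← Multiset.coe_add, Multiset.coe_replicate]
  abel

lemma packIn_w {k l : ℕ} (hcomp : (compatible S.w S.Y).card ≤ 3 * k)
    (hconf : (conflicting S.w S.Y).card ≤ 4 * l) (hX : 2 * K ≤ 2 * k + 3 * l)
    (hZ : 6 * K ≤ 6 * k + 8 * l) :
    PackIn (k + l) ↑(S.Z ++ S.X ++ S.Y ++ .replicate k S.w) := by
  have := packIn_thirds_add_replicate (n := S.Z) (q := S.X) S.twoThirds_w
    (fun _ => side_le_of_mem_compatible) (fun s hs => S.third s (mem_of_mem_conflicting hs))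
    S.quarter S.small hcomp hconf (by simpa [S.length_X]) (by simpa [S.length_Z])
  rwa [compatible_add_conflicting] at this

lemma six_mul_le_mul_opt (l : List Item) : 6 * K ≤ 144 * opt (S.Z ++ l) := by
  simpa [S.length_Z] using card_le_mul_opt (k := 13) (m := S.Z) (I := S.Z ++ l)
    (fun s hs => by push_cast; linarith [(S.small s hs).1]) (by simp [← Multiset.coe_add])

end Adversary

lemma exists_mul_opt_le_cost_add_two (A : OnlineAlgorithm) (Q : ℕ) :
    ∃ I, Q ≤ opt I ∧ 5463 / 3103 * opt I ≤ (A.cost I + 2 : ℝ) := by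
  by_contra! h
  obtain ⟨S⟩ := Adversary.nonempty A (24 * Q)
  have hcost (l : List Item) : (A.cost (S.Z ++ l) + 2 : ℝ) ≤ 5463 / 3103 * opt (S.Z ++ l) :=
    (h _ (by have := S.six_mul_le_mul_opt l; omega)).le
  have hX := card_compatible_add_card_conflicting S.u S.X
  have hY := card_compatible_add_card_conflicting S.w S.Y
  rw [Multiset.coe_card, S.length_X] at hX
  rw [Multiset.coe_card, S.length_Y] at hY
  have ceil (m d : ℕ) (hd : 0 < d) : ∃ k, m ≤ d * k ∧ d * k ≤ m + d :=
    ⟨m / d + 1, (Nat.lt_mul_div_succ m hd).le, by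
      rw [mul_add, mul_one]
      exact Nat.add_le_add_right (Nat.mul_div_le m d) d⟩
  obtain ⟨M, hM, hM'⟩ := ceil (compatible S.u S.X).card 5 (by norm_num)
  obtain ⟨x, hx, hx'⟩ := ceil (conflicting S.u S.X).card 9 (by norm_num)
  obtain ⟨N, hN, hN'⟩ := ceil (compatible S.w S.Y).card 3 (by norm_num)
  obtain ⟨y, hy, hy'⟩ := ceil (conflicting S.w S.Y).card 4 (by norm_num)
  have hR : (0 : ℝ) ≤ 5463 / 3103 := by norm_num
  have stop_Z := card_bins_le_of_packIn (k := Q) hR (by simpa using hcost [])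
    (S.packIn_Z (by omega))
  have stop_u := card_bins_add_le_of_packIn hR (by linarith [S.threeQuarters.1])
    (by simpa using hcost _) (S.packIn_u hM hx (by omega))
  have stop_v := card_bins_add_le_of_packIn hR (by linarith [S.twoThirds_v.1])
    (by simpa using hcost _) S.packIn_v
  have stop_w := card_bins_add_le_of_packIn hR (by linarith [S.twoThirds_w.1])
    (by simpa using hcost _) (S.packIn_w hN hy (by omega) (by omega))
  have reused := S.card_reusedBins_le M (24 * Q) N
  have opened_X := S.card_bins_quarters
  have opened_Y := S.card_bins_thirds
  rw [S.length_Z, S.length_X, S.length_Y] at reused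
  rify at hX hY hM' hx' hN' hy' reused opened_X opened_Y
  push_cast at stop_u stop_v stop_w
  -- With weights `280`, `168`, `28` and `100` for the four stops the numbers of bins cancel.
  linarith

lemma ofReal_le_competitiveRatio {A : OnlineAlgorithm} {R c : ℝ}
    (h : ∀ Q : ℕ, ∃ I, Q ≤ opt I ∧ R * opt I ≤ A.cost I + c) :
    ENNReal.ofReal R ≤ A.competitiveRatio := by
  refine le_of_forall_lt_imp_le_of_dense fun r hr =>
    Filter.le_limsup_of_frequently_le' (Filter.frequently_atTop.2 fun Q => ?_)
  lift r to NNReal using hr.ne_top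
  have hrR : (r : ℝ) < R := by simpa using (ENNReal.lt_ofReal_iff_toReal_lt hr.ne_top).1 hr
  obtain ⟨Q', hQ'⟩ := exists_nat_ge (c / (R - r))
  obtain ⟨I, hI, hcost⟩ := h (max (Q + 1) Q')
  have hpos : opt I ≠ 0 := by omega
  refine ⟨opt I, by omega, ?_⟩
  rw [ENNReal.le_div_iff_mul_le (.inl (by simpa using hpos)) (.inl (ENNReal.natCast_ne_top _))]
  have hrcost : r * opt I ≤ (A.cost I : ℝ) := by
    have hc : c / (R - r) ≤ opt I := hQ'.trans (mod_cast (le_max_right _ _).trans hI)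
    rw [div_le_iff₀ (sub_pos.2 hrR)] at hc
    linarith
  calc (r * opt I : ℝ≥0∞) ≤ A.cost I := mod_cast hrcost
    _ ≤ A.worstCost (opt I) :=
        le_iSup₂ (f := fun J (_ : opt J = opt I) => (A.cost J : ℝ≥0∞)) I rfl

end OnlineAlgorithm

end SquarePacking

theorem theorem3_general (A : SquarePacking.OnlineAlgorithm) :
    ENNReal.ofReal (5463 / 3103) ≤ A.competitiveRatio :=
  SquarePacking.OnlineAlgorithm.ofReal_le_competitiveRatio A.exists_mul_opt_le_cost_add_two

theorem theorem3 (A : SquarePacking.OnlineAlgorithm) :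
    ENNReal.ofReal 1.7515445 ≤ A.competitiveRatio :=
  (ENNReal.ofReal_le_ofReal (by norm_num)).trans (theorem3_general A)
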